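/- Let $n$ be an odd positive integer, let $k\ge 0$ be an integer with $\gcd(k,n)=1$, let $L=GF(2^n)$, and let $f,g:L\to L$ be $$f(x)=x^{2^{2k}-2^k+1},\qquad g(x)=x^{2^{4k}-2^{3k}+2^{2k}-2^k+1}.$$ Fix a basis of $L$ over $GF(2)$, let $H$ be the binary $3n\times(2^n-1)$ matrix whose column indexed by $x\in L^*$ consists of the coordinates of $x$, $f(x)$ and $g(x)$ in this basis, and let $C$ be the null space of $H$, a binary linear code of length $2^n-1$. Then: 1. For all $a,b,c\in L$ that are not all zero, the generalised Walsh transform $$\sum_{x\in L}(-1)^{\mathrm{Tr}(ax+bf(x)+cg(x))}$$ takes one of the values $0,\ \pm 2^{(n+1)/2},\ \pm 2^{(n+3)/2}$, where $\mathrm{Tr}$ is the absolute trace $L\to GF(2)$. 2. If $n\ge 3$, the code $C$ has minimum distance $7$, i.e. it is triple-error-correcting; if $n\ge 5$, it has parameters $[2^n-1,\ 2^n-3n-1,\ 7]$. 3. $C$ has the same weight distribution as the triple-error-correcting BCH code, that is, the code constructed in the same way from the pair $x^3,\ x^5$: for every $w$ the two codes have the same number of words of weight $w$. -/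

import Mathlib

namespace TripleCode

/-- The power function `x ↦ x ^ (2^(2k) - 2^k + 1)`. No subtraction in the exponent truncates. -/
def powF {L : Type*} [Field L] (k : ℕ) (x : L) : L :=
  x ^ (2 ^ (2 * k) - 2 ^ k + 1)

/-- The power function `x ↦ x ^ (2^(4k) - 2^(3k) + 2^(2k) - 2^k + 1)`. No subtraction in the
exponent truncates. -/
def powG {L : Type*} [Field L] (k : ℕ) (x : L) : L :=
  x ^ (2 ^ (4 * k) - 2 ^ (3 * k) + 2 ^ (2 * k) - 2 ^ k + 1)

/-- The binary `3n × (2^n - 1)` matrix whose column at a nonzero `x` consists of the coordinates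
of `x`, `f x`, `g x` with respect to the basis `B`. -/
noncomputable def parityCheck {L : Type*} [Field L] [Algebra (ZMod 2) L] {n : ℕ}
    (B : Module.Basis (Fin n) (ZMod 2) L) (f g : L → L) :
    Matrix (Fin 3 × Fin n) Lˣ (ZMod 2) :=
  Matrix.of fun r x => B.repr ((![(x : L), f (x : L), g (x : L)] : Fin 3 → L) r.1) r.2

/-- The binary code of length `2^n - 1` which is the null space of the parity-check matrix. -/
noncomputable def code {L : Type*} [Field L] [Fintype L] [DecidableEq L] [Algebra (ZMod 2) L]
    {n : ℕ} (B : Module.Basis (Fin n) (ZMod 2) L) (f g : L → L) :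
    Submodule (ZMod 2) (Lˣ → ZMod 2) :=
  LinearMap.ker (parityCheck B f g).mulVecLin

/-- The primitive binary BCH code of designed distance `7`, given by the pair `x^3`, `x^5`. -/
noncomputable def bchCode {L : Type*} [Field L] [Fintype L] [DecidableEq L] [Algebra (ZMod 2) L]
    {n : ℕ} (B : Module.Basis (Fin n) (ZMod 2) L) : Submodule (ZMod 2) (Lˣ → ZMod 2) :=
  code B (fun x => x ^ 3) (fun x => x ^ 5)

/-- `d` is the minimum Hamming distance between two distinct words of `C`
(in particular, two distinct words exist). -/
def HasMinDist {ι : Type*} [Fintype ι] (C : Submodule (ZMod 2) (ι → ZMod 2)) (d : ℕ) : Prop :=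
  IsLeast {m : ℕ | ∃ u ∈ C, ∃ v ∈ C, u ≠ v ∧ hammingDist u v = m} d

/-- `C` is a binary linear `[N, κ, d]` code: length `N`, dimension `κ`, minimum distance `d`. -/
def HasParameters {ι : Type*} [Fintype ι] (C : Submodule (ZMod 2) (ι → ZMod 2)) (N κ d : ℕ) :
    Prop :=
  Fintype.card ι = N ∧ Module.finrank (ZMod 2) C = κ ∧ HasMinDist C d

/-- The number of words of `C` of Hamming weight `w`. -/
noncomputable def weightCount {ι : Type*} [Fintype ι] (C : Submodule (ZMod 2) (ι → ZMod 2))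
    (w : ℕ) : ℕ :=
  Set.ncard {u : ι → ZMod 2 | u ∈ C ∧ hammingNorm u = w}

/-- The generalised Fourier (Walsh) transform
`∑ x, (-1) ^ Tr (a x + b f(x) + c g(x))`, with `Tr` the absolute trace. -/
noncomputable def fourier {L : Type*} [Field L] [Fintype L] [Algebra (ZMod 2) L]
    (f g : L → L) (a b c : L) : ℤ :=
  ∑ x : L, (-1 : ℤ) ^ (Algebra.trace (ZMod 2) L (a * x + b * f x + c * g x)).val

end TripleCode

/-
Substituting `x * σ x` for `x`, where `σ x = x ^ 2 ^ k`, turns `Tr (a x + b f x + c g x)` into the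
trace of a combination of `x * σ x`, `x * σ ^ 3 x` and `x * σ ^ 5 x`, a quadratic form over
`GF(2)`. The sum `W` of its signs satisfies `W ^ 2 = 0` or `W ^ 2 = q * 2 ^ r`, where `q = 2 ^ n`
and `r`, odd like `n`, is the dimension of the kernel of the polar form. That kernel consists of
roots of a polynomial of degree at most five in `σ ^ 2`, so `r ≤ 5`; if `r` were the full degree,
the conjugates of a basis of the kernel would give an alternating Gram matrix of odd size and
nonzero determinant. Hence `W ^ 2` is `0`, `2 q` or `8 q`, and `8 q` needs `c ≠ 0`. For `x ^ 3` and
`x ^ 5` the same holds without substitution, the kernel having dimension at most four.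

Moments of `W` count tuples of columns with sum zero. The values at `c = 0` show that all zero-sum
quadruples of pairs `(x, f x)`, hence of columns, are trivial; then `W ^ 2 (W ^ 2 - 2 q)
(W ^ 2 - 8 q) = 0` off the origin shows the same for sextuples, so nonzero codewords have weight at
least seven. The first six moments thus agree for the two codes and determine how often `W` takes
each of its at most six values, and these frequencies determine the weights as in the MacWilliams
identities. A three-dimensional subspace of `L` supports a word of weight seven in the BCH code.
-/

namespace TripleCode

open Finset Module Matrix

theorem det_eq_zero_of_alternating_of_odd_card {R n : Type*} [CommRing R] [Fintype n]
    [DecidableEq n] (hn : Odd (Fintype.card n)) (M : Matrix n n R) (hdiag : ∀ i, M i i = 0)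
    (hskew : ∀ i j, M j i = -M i j) : M.det = 0 := by
  rw [det_apply]
  refine sum_involution (fun σ _ => σ⁻¹) (fun σ _ => ?_) (fun σ _ hne hσ => hne ?_)
    (fun _ _ => mem_univ _) (fun _ _ => inv_inv _)
  · have : ∏ i, M (σ⁻¹ i) i = -∏ i, M (σ i) i := by
      rw [← Equiv.prod_comp σ]
      simp only [Equiv.Perm.inv_def, Equiv.symm_apply_apply, hskew (σ _) _, prod_neg,
        card_univ, hn.neg_one_pow, neg_one_mul]
    rw [Equiv.Perm.sign_inv, this, smul_neg, add_neg_cancel]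
  · obtain ⟨i, hi⟩ : ∃ i, σ i = i :=
      Equiv.Perm.exists_fixed_point_of_prime (p := 2) (n := 1) hn.not_two_dvd_nat
        (by rw [pow_one, pow_two]; exact mul_eq_one_iff_inv_eq.2 hσ)
    rw [prod_eq_zero (mem_univ i) (by rw [hi, hdiag]), smul_zero]

section Conjugates

variable {K L : Type*} [Field K] [Field L] [Algebra K L]

theorem sum_range_pow_apply_sub (τ : L ≃ₐ[K] L) (y : L) (i : ℕ) :
    ∑ j ∈ range i, (τ ^ j) (τ y - y) = (τ ^ i) y - y := by
  have hterm (j : ℕ) : (τ ^ j) (τ y - y) = (τ ^ (j + 1)) y - (τ ^ j) y := by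
    rw [map_sub, pow_succ, AlgEquiv.mul_apply]
  simp_rw [hterm, sum_range_sub fun j => (τ ^ j) y, pow_zero, AlgEquiv.one_apply]

theorem finrank_le_of_sum_mul_pow_eq_zero [FiniteDimensional K L] (τ : L ≃ₐ[K] L)
    (hτ : ∀ x, τ x = x → x ∈ Set.range (algebraMap K L)) (d : ℕ) (l : ℕ → L) (hl : l d ≠ 0)
    (R : Submodule K L) (hR : ∀ u ∈ R, ∑ j ∈ range (d + 1), l j * (τ ^ j) u = 0) :
    finrank K R ≤ d := by
  induction d generalizing l R with
  | zero =>
    have hbot : R = ⊥ := R.eq_bot_iff.2 fun u hu => by simpa [hl] using hR u hu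
    simp [hbot]
  | succ d ih =>
    obtain rfl | hbot := eq_or_ne R ⊥
    · simp
    obtain ⟨v, hvR, hv⟩ := Submodule.exists_mem_ne_zero_of_ne_bot hbot
    -- Solutions divided by one of them include the constants; `τ - 1` kills these and lowers `d`.
    let φ : L →ₗ[K] L := (τ.toLinearMap - LinearMap.id) ∘ₗ LinearMap.mulLeft K v⁻¹
    have hφ (u : L) : φ u = τ (v⁻¹ * u) - v⁻¹ * u := rfl
    have hker : finrank K (LinearMap.ker (φ.domRestrict R)) ≤ 1 := by
      refine finrank_le_one ⟨⟨v, hvR⟩, by simp [LinearMap.mem_ker, hφ, hv]⟩ ?_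
      rintro ⟨⟨w, hwR⟩, hw⟩
      obtain ⟨c, hc⟩ := hτ _ (sub_eq_zero.1 hw)
      refine ⟨c, Subtype.ext <| Subtype.ext ?_⟩
      change c • v = w
      rw [Algebra.smul_def, hc, LinearMap.mulLeft_apply, mul_right_comm, inv_mul_cancel₀ hv,
        one_mul, R.subtype_apply]
    have hrank := LinearMap.finrank_range_add_finrank_ker (φ.domRestrict R)
    rw [LinearMap.range_domRestrict] at hrank
    suffices finrank K (R.map φ) ≤ d by lia
    refine ih (fun j => ∑ i ∈ Ico (j + 1) (d + 2), l i * (τ ^ i) v) ?_ _ ?_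
    · simpa only [Nat.Ico_succ_singleton, sum_singleton] using
        mul_ne_zero hl ((map_ne_zero _).2 hv)
    rintro _ ⟨u, hu, rfl⟩
    obtain ⟨y, rfl⟩ : ∃ y, u = v * y := ⟨v⁻¹ * u, (mul_inv_cancel_left₀ hv u).symm⟩
    calc ∑ j ∈ range (d + 1), (∑ i ∈ Ico (j + 1) (d + 2), l i * (τ ^ i) v) * (τ ^ j) (φ (v * y))
        = ∑ i ∈ range (d + 2), (l i * (τ ^ i) v) * ∑ j ∈ range i, (τ ^ j) (τ y - y) := by
          simp_rw [hφ, inv_mul_cancel_left₀ hv, sum_mul, mul_sum]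
          exact sum_comm' fun i j => by simp only [mem_range, mem_Ico]; lia
      _ = ∑ i ∈ range (d + 2), l i * (τ ^ i) (v * y) -
            (∑ i ∈ range (d + 2), l i * (τ ^ i) v) * y := by
          simp_rw [sum_range_pow_apply_sub, map_mul, sum_mul, ← sum_sub_distrib]
          exact sum_congr rfl fun i _ => by ring
      _ = 0 := by rw [hR _ hu, hR v hvR, zero_mul, sub_zero]

theorem det_moore_ne_zero [FiniteDimensional K L] (τ : L ≃ₐ[K] L)
    (hτ : ∀ x, τ x = x → x ∈ Set.range (algebraMap K L)) {m : ℕ} {z : Fin m → L}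
    (hz : LinearIndependent K z) : (of fun i j : Fin m => (τ ^ (j : ℕ)) (z i)).det ≠ 0 := by
  intro hdet
  obtain ⟨v, hv, hvz⟩ := exists_mulVec_eq_zero_iff.2 hdet
  obtain ⟨d, hd, hmax⟩ := (Set.toFinite {j | v j ≠ 0}).exists_maximal (Function.ne_iff.1 hv)
  let l (j : ℕ) : L := if h : j < m then v ⟨j, h⟩ else 0
  have hl (j : Fin m) : l j = v j := dif_pos j.2
  have hl_zero (j : ℕ) (hdj : d < j) : l j = 0 := by
    unfold l
    split_ifs with h
    · by_contra hj
      exact absurd (hmax (y := ⟨j, h⟩) hj hdj.le) hdj.not_ge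
    · rfl
  let Φ : L →ₗ[K] L := ∑ j ∈ range (d + 1), LinearMap.mulLeft K (l j) ∘ₗ (τ ^ j).toLinearMap
  have hΦ (u : L) : Φ u = ∑ j ∈ range (d + 1), l j * (τ ^ j) u := by
    simp [Φ, LinearMap.sum_apply]
  have hspan : Submodule.span K (Set.range z) ≤ LinearMap.ker Φ := by
    refine Submodule.span_le.2 ?_
    rintro _ ⟨i, rfl⟩
    calc Φ (z i) = ∑ j ∈ range m, l j * (τ ^ j) (z i) := by
          rw [hΦ]
          refine sum_subset (range_mono d.2) fun j _ hj => ?_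
          rw [hl_zero j (by simpa using hj), zero_mul]
      _ = (of (fun i j : Fin m => (τ ^ (j : ℕ)) (z i)) *ᵥ v) i := by
          simp only [sum_range, hl, mulVec, dotProduct, of_apply, mul_comm]
      _ = 0 := congrFun hvz i
  have hrank := finrank_le_of_sum_mul_pow_eq_zero τ hτ d l (by rwa [hl]) _ fun u hu =>
    (hΦ u).symm.trans (hspan hu)
  rw [finrank_span_eq_card hz, Fintype.card_fin] at hrank
  lia

theorem exists_conjugate_form_ne_zero [FiniteDimensional K L] (τ : L ≃ₐ[K] L)
    (hτ : ∀ x, τ x = x → x ∈ Set.range (algebraMap K L)) (β : L ≃ₐ[K] L) {m : ℕ} (hm : Odd m)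
    (N : Matrix (Fin m) (Fin m) L) (hN : N.det ≠ 0)
    (R : Submodule K L) (hR : finrank K R = m) :
    ∃ z ∈ R, ∑ i : Fin m, ∑ j : Fin m,
      (τ ^ (i : ℕ)) z * N i j * (τ ^ (j : ℕ)) (β z) ≠ 0 := by
  by_contra! hform
  let b := finBasisOfFinrankEq K R hR
  let z (i : Fin m) : L := b i
  have hz : LinearIndependent K z := b.linearIndependent.map' R.subtype R.ker_subtype
  have hβz : LinearIndependent K (β ∘ z) :=
    hz.map' β.toLinearMap (LinearMap.ker_eq_bot.2 β.injective)
  let form (x y : L) : L :=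
    ∑ i : Fin m, ∑ j : Fin m, (τ ^ (i : ℕ)) x * N i j * (τ ^ (j : ℕ)) (β y)
  have form_add (x y : L) :
      form (x + y) (x + y) = form x x + form x y + form y x + form y y := by
    simp only [form, map_add, ← sum_add_distrib]
    exact sum_congr rfl fun i _ => sum_congr rfl fun j _ => by ring
  have form_self : ∀ x ∈ R, form x x = 0 := hform
  let gram : Matrix (Fin m) (Fin m) L := of fun p q => form (z p) (z q)
  have det_gram : gram.det = 0 := by
    refine det_eq_zero_of_alternating_of_odd_card (by rwa [Fintype.card_fin]) gram
      (fun p => form_self _ (b p).2) fun p q => ?_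
    have h := form_add (z p) (z q)
    rw [form_self _ (b p).2, form_self _ (b q).2,
      form_self _ (R.add_mem (b p).2 (b q).2), zero_add, add_zero] at h
    exact eq_neg_of_add_eq_zero_right h.symm
  have gram_eq : gram = of (fun i j : Fin m => (τ ^ (j : ℕ)) (z i)) * N *
      (of fun i j : Fin m => (τ ^ (j : ℕ)) ((β ∘ z) i))ᵀ := by
    ext p q
    simp only [gram, form, of_apply, mul_apply, transpose_apply, sum_mul, Function.comp_apply]
    exact sum_comm
  rw [gram_eq, det_mul, det_mul, det_transpose] at det_gram
  exact mul_ne_zero (mul_ne_zero (det_moore_ne_zero τ hτ hz) hN) (det_moore_ne_zero τ hτ hβz)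
    det_gram

end Conjugates

section Characters

/-- The nontrivial additive character `z ↦ (-1) ^ z` of `ZMod 2`. -/
noncomputable def sgn : AddChar (ZMod 2) ℤ := AddChar.zmodChar 2 (ζ := -1) (by norm_num)

theorem sgn_apply (z : ZMod 2) : sgn z = (-1) ^ z.val := AddChar.zmodChar_apply _ z

theorem sgn_zero : sgn 0 = 1 := sgn.map_zero_eq_one

theorem sgn_one : sgn 1 = -1 := sgn_apply 1

theorem sgn_of_ne_zero {z : ZMod 2} (hz : z ≠ 0) : sgn z = -1 := by
  have hz₁ : z = 1 := Fin.eq_one_of_ne_zero z hz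
  rw [hz₁, sgn_one]

theorem sgn_mul_self (z : ZMod 2) : sgn z * sgn z = 1 := by
  rw [← sgn.map_add_eq_mul, CharTwo.add_self_eq_zero, sgn_zero]

theorem sgn_sum {ι : Type*} (s : Finset ι) (z : ι → ZMod 2) :
    sgn (∑ i ∈ s, z i) = ∏ i ∈ s, sgn (z i) :=
  map_prod sgn.toMonoidHom (fun i => Multiplicative.ofAdd (z i)) s

theorem sgn_injective : Function.Injective sgn := by
  intro z w h
  rw [sgn_apply, sgn_apply] at h
  revert z w
  decide

open Classical in
theorem sum_sgn_dual {V : Type*} [AddCommGroup V] [Module (ZMod 2) V] [Fintype V]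
    (f : Dual (ZMod 2) V) : ∑ v, sgn (f v) = if f = 0 then (Fintype.card V : ℤ) else 0 := by
  let ψ := sgn.compAddMonoidHom f.toAddMonoidHom
  have hψ : ψ = 0 ↔ f = 0 := by
    simp only [DFunLike.ext_iff, AddChar.zero_apply, LinearMap.zero_apply]
    exact forall_congr' fun v => by rw [← sgn_zero]; exact sgn_injective.eq_iff
  exact ψ.sum_eq_ite.trans (if_congr hψ rfl rfl)

variable {K : Type*} [Field K] [Algebra (ZMod 2) K]

/-- The absolute trace of an extension of `ZMod 2`. -/
noncomputable abbrev tr : K →ₗ[ZMod 2] ZMod 2 := Algebra.trace (ZMod 2) K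

theorem forall_tr_mul_eq_zero_iff [Finite K] {y : K} : (∀ x, tr (x * y) = 0) ↔ y = 0 := by
  refine ⟨fun h => (traceForm_nondegenerate (ZMod 2) K).1 y fun x => ?_, fun h => by simp [h]⟩
  rw [Algebra.traceForm_apply, mul_comm]
  exact h x

variable {ι : Type*} [Fintype ι]

open Classical in
theorem sum_sgn_tr_dotProduct [Fintype K] [DecidableEq ι] (v : ι → K) :
    ∑ t : ι → K, sgn (tr (t ⬝ᵥ v)) = if v = 0 then (Fintype.card (ι → K) : ℤ) else 0 := by
  let f : Dual (ZMod 2) (ι → K) := tr ∘ₗ (dotProductBilin (ZMod 2) (ZMod 2)).flip v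
  have hf : f = 0 ↔ v = 0 := by
    refine ⟨fun h => funext fun i => forall_tr_mul_eq_zero_iff.1 fun x => ?_, ?_⟩
    · simpa [f] using DFunLike.congr_fun h (Pi.single i x)
    · rintro rfl
      ext t
      simp [f]
  exact (sum_sgn_dual f).trans (if_congr hf rfl rfl)

variable {X : Type*} [Fintype X]

/-- The Walsh transform at `t` of a family of vectors `φ`. With values in `L ^ 3` it is the
transform `fourier` of the statement, and with values in `(ZMod 2) ^ m` a plain character sum. -/
noncomputable def walsh (φ : X → ι → K) (t : ι → K) : ℤ := ∑ x, sgn (tr (t ⬝ᵥ φ x))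

theorem walsh_zero (φ : X → ι → K) : walsh φ 0 = Fintype.card X := by
  simp [walsh]

theorem walsh_pow (φ : X → ι → K) (t : ι → K) (j : ℕ) :
    walsh φ t ^ j = walsh (fun x : Fin j → X => ∑ i, φ (x i)) t := by
  simp only [walsh, Fintype.sum_pow, dotProduct_sum, map_sum, sgn_sum]

open Classical in
theorem sum_walsh [Fintype K] [DecidableEq ι] (φ : X → ι → K) :
    ∑ t, walsh φ t = Fintype.card (ι → K) * #{x | φ x = 0} := by
  simp_rw [walsh]
  rw [sum_comm]
  simp_rw [sum_sgn_tr_dotProduct]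
  rw [← sum_filter, sum_const, nsmul_eq_mul, mul_comm]

/-- The `j`-tuples whose images under `φ` sum to zero. -/
noncomputable def zeroSumTuples {V : Type*} [AddCommMonoid V] (φ : X → V) (j : ℕ) :
    Finset (Fin j → X) :=
  open Classical in {x | ∑ i, φ (x i) = 0}

theorem mem_zeroSumTuples {V : Type*} [AddCommMonoid V] {φ : X → V} {j : ℕ} {x : Fin j → X} :
    x ∈ zeroSumTuples φ j ↔ ∑ i, φ (x i) = 0 := by
  simp [zeroSumTuples]

theorem sum_walsh_pow [Fintype K] [DecidableEq ι] (φ : X → ι → K) (j : ℕ) :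
    ∑ t, walsh φ t ^ j = Fintype.card (ι → K) * #(zeroSumTuples φ j) := by
  simp_rw [walsh_pow]
  convert sum_walsh fun x : Fin j → X => ∑ i, φ (x i)
  ext x
  simp [mem_zeroSumTuples]

end Characters

section QuadraticSums

variable {V : Type*} [AddCommGroup V] [Module (ZMod 2) V] [Fintype V] {Q : V → ZMod 2}
  {B : LinearMap.BilinForm (ZMod 2) V}

theorem sum_sgn_eq_zero_of_mem_ker (hQ : ∀ x y, Q (x + y) = Q x + Q y + B x y) {u : V}
    (hu : u ∈ LinearMap.ker B) (hQu : Q u ≠ 0) : ∑ x, sgn (Q x) = 0 := by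
  have hflip : ∑ x, sgn (Q x) = -∑ x, sgn (Q x) := by
    calc ∑ x, sgn (Q x) = ∑ x, sgn (Q (u + x)) :=
          (Equiv.sum_comp (Equiv.addLeft u) fun x => sgn (Q x)).symm
      _ = -∑ x, sgn (Q x) := by
          simp_rw [hQ, LinearMap.mem_ker.1 hu, LinearMap.zero_apply, add_zero,
            sgn.map_add_eq_mul, sgn_of_ne_zero hQu, neg_one_mul, sum_neg_distrib]
  lia

theorem sq_sum_sgn_of_forall_mem_ker (hQ : ∀ x y, Q (x + y) = Q x + Q y + B x y)
    (hker : ∀ u ∈ LinearMap.ker B, Q u = 0) :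
    (∑ x, sgn (Q x)) ^ 2 = Fintype.card V * 2 ^ finrank (ZMod 2) (LinearMap.ker B) := by
  classical
  calc (∑ x, sgn (Q x)) ^ 2 = ∑ x, ∑ y, sgn (Q x) * sgn (Q y) := by rw [pow_two, sum_mul_sum]
    _ = ∑ x, ∑ u, sgn (Q x) * sgn (Q (u + x)) :=
        sum_congr rfl fun x _ =>
          (Equiv.sum_comp (Equiv.addRight x) fun y => sgn (Q x) * sgn (Q y)).symm
    _ = ∑ u, sgn (Q u) * ∑ x, sgn (B u x) := by
        rw [sum_comm]
        simp_rw [mul_sum, hQ, sgn.map_add_eq_mul]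
        refine sum_congr rfl fun u _ => sum_congr rfl fun x _ => ?_
        linear_combination sgn (Q u) * sgn (B u x) * sgn_mul_self (Q x)
    _ = ∑ u, if u ∈ LinearMap.ker B then (Fintype.card V : ℤ) else 0 := by
        refine sum_congr rfl fun u _ => ?_
        rw [sum_sgn_dual, LinearMap.mem_ker]
        split_ifs with hu
        · rw [hker u hu, sgn_zero, one_mul]
        · rw [mul_zero]
    _ = Fintype.card V * 2 ^ finrank (ZMod 2) (LinearMap.ker B) := by
        rw [← sum_filter, sum_const, nsmul_eq_mul, mul_comm, ← Fintype.card_subtype]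
        have := Module.card_eq_pow_finrank (K := ZMod 2) (V := LinearMap.ker B)
        rw [ZMod.card] at this
        exact_mod_cast congrArg _ this

theorem even_of_sq_eq_two_pow {S : ℤ} {m : ℕ} (h : S ^ 2 = 2 ^ m) : Even m := by
  have hnat : S.natAbs ^ 2 = 2 ^ m := by zify; rwa [sq_abs]
  have hfact := congrArg (fun k => k.factorization 2) hnat
  simp only [Nat.factorization_pow, Finsupp.smul_apply, Nat.prime_two.factorization_self,
    smul_eq_mul, mul_one] at hfact
  exact hfact ▸ even_two_mul _

theorem sq_sum_sgn_of_odd_finrank (hV : Odd (finrank (ZMod 2) V))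
    (hQ : ∀ x y, Q (x + y) = Q x + Q y + B x y) :
    (∑ x, sgn (Q x)) ^ 2 = 0 ∨ (∀ u ∈ LinearMap.ker B, Q u = 0) ∧
      Odd (finrank (ZMod 2) (LinearMap.ker B)) ∧
      (∑ x, sgn (Q x)) ^ 2 = Fintype.card V * 2 ^ finrank (ZMod 2) (LinearMap.ker B) := by
  by_cases hker : ∀ u ∈ LinearMap.ker B, Q u = 0
  · have hsq := sq_sum_sgn_of_forall_mem_ker hQ hker
    refine Or.inr ⟨hker, ?_, hsq⟩
    rw [Module.card_eq_pow_finrank (K := ZMod 2), ZMod.card, Nat.cast_pow, Nat.cast_ofNat,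
      ← pow_add] at hsq
    exact (Nat.even_add'.1 (even_of_sq_eq_two_pow hsq)).1 hV
  · push Not at hker
    obtain ⟨u, hu, hQu⟩ := hker
    exact Or.inl (by rw [sum_sgn_eq_zero_of_mem_ker hQ hu hQu, zero_pow two_ne_zero])

theorem sq_sum_sgn_of_tr_polar {L : Type*} [Field L] [Fintype L] [Algebra (ZMod 2) L]
    (hL : Odd (finrank (ZMod 2) L)) {Q : L → ZMod 2} {Λ : L →ₗ[ZMod 2] L}
    (hQ : ∀ x y, Q (x + y) = Q x + Q y + tr (Λ x * y)) :
    (∑ x, sgn (Q x)) ^ 2 = 0 ∨ (∀ u ∈ LinearMap.ker Λ, Q u = 0) ∧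
      Odd (finrank (ZMod 2) (LinearMap.ker Λ)) ∧
      (∑ x, sgn (Q x)) ^ 2 = Fintype.card L * 2 ^ finrank (ZMod 2) (LinearMap.ker Λ) := by
  have hker : LinearMap.ker (Algebra.traceForm (ZMod 2) L ∘ₗ Λ) = LinearMap.ker Λ :=
    LinearMap.ker_comp_of_ker_eq_bot _
      (LinearMap.separatingLeft_iff_ker_eq_bot.1 (traceForm_nondegenerate (ZMod 2) L).1)
  rw [← hker]
  exact sq_sum_sgn_of_odd_finrank hL hQ

end QuadraticSums

section ConjugationForms

variable {L : Type*} [Field L] [Algebra (ZMod 2) L]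

/-- The form `∑ m < M, a m * x * σ ^ (m + 1) x` whose trace is a quadratic form over `ZMod 2`. -/
def conjForm (σ : L ≃ₐ[ZMod 2] L) (a : ℕ → L) (M : ℕ) (x : L) : L :=
  ∑ m ∈ range M, a m * (x * (σ ^ (m + 1)) x)

/-- The linear map that represents the polar form of `tr ∘ conjForm σ a M` through the trace
pairing. -/
def conjPolar (σ : L ≃ₐ[ZMod 2] L) (a : ℕ → L) (M : ℕ) : L →ₗ[ZMod 2] L :=
  ∑ m ∈ range M, ((σ ^ (m + 1)).symm.toLinearMap ∘ₗ LinearMap.mulLeft (ZMod 2) (a m) +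
    LinearMap.mulLeft (ZMod 2) (a m) ∘ₗ (σ ^ (m + 1)).toLinearMap)

variable {σ : L ≃ₐ[ZMod 2] L} {a : ℕ → L} {M : ℕ}

theorem conjForm_of_le {N : ℕ} (hle : ∀ m, M ≤ m → a m = 0) (hMN : M ≤ N) (x : L) :
    conjForm σ a N x = conjForm σ a M x :=
  (sum_subset (range_mono hMN) fun m _ hm => by
    rw [hle m (by simpa using hm), zero_mul]).symm

theorem conjPolar_apply (x : L) : conjPolar σ a M x =
    ∑ m ∈ range M, ((σ ^ (m + 1)).symm (a m * x) + a m * (σ ^ (m + 1)) x) := by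
  simp [conjPolar, LinearMap.sum_apply]

theorem tr_conjForm_add (x y : L) : tr (conjForm σ a M (x + y)) =
    tr (conjForm σ a M x) + tr (conjForm σ a M y) + tr (conjPolar σ a M x * y) := by
  simp only [conjForm, conjPolar_apply, sum_mul, map_sum, ← sum_add_distrib]
  refine sum_congr rfl fun m _ => ?_
  have hadj : tr ((σ ^ (m + 1)).symm (a m * x) * y) = tr (a m * x * (σ ^ (m + 1)) y) := by
    rw [← Algebra.trace_eq_of_algEquiv (σ ^ (m + 1)), map_mul, AlgEquiv.apply_symm_apply]
  calc tr (a m * ((x + y) * (σ ^ (m + 1)) (x + y)))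
      = tr (a m * (x * (σ ^ (m + 1)) x)) + tr (a m * (y * (σ ^ (m + 1)) y)) +
          (tr (a m * x * (σ ^ (m + 1)) y) + tr (a m * (σ ^ (m + 1)) x * y)) := by
        simp only [← map_add tr, map_add (σ ^ (m + 1))]
        exact congrArg tr (by ring)
    _ = _ := by rw [add_mul, map_add, hadj]

/-- The coefficients of `σ ^ M ∘ conjPolar σ a M` as a polynomial in `σ`. -/
def conjPolarCoeff (σ : L ≃ₐ[ZMod 2] L) (a : ℕ → L) (M j : ℕ) : L :=
  if j < M then (σ ^ j) (a (M - 1 - j)) else if j = M then 0 else (σ ^ M) (a (j - M - 1))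

theorem conjPolarCoeff_of_lt {j : ℕ} (hj : j < M) :
    conjPolarCoeff σ a M j = (σ ^ j) (a (M - 1 - j)) := if_pos hj

theorem conjPolarCoeff_self : conjPolarCoeff σ a M M = 0 := by simp [conjPolarCoeff]

theorem conjPolarCoeff_add (m : ℕ) : conjPolarCoeff σ a M (M + 1 + m) = (σ ^ M) (a m) := by
  rw [conjPolarCoeff, if_neg (by lia), if_neg (by lia)]
  congr 2
  lia

theorem pow_conjPolar (x : L) : (σ ^ M) (conjPolar σ a M x) =
    ∑ j ∈ range (2 * M + 1), conjPolarCoeff σ a M j * (σ ^ j) x := by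
  rw [show 2 * M + 1 = M + 1 + M by lia, sum_range_add, sum_range_succ, conjPolarCoeff_self,
    zero_mul, add_zero, conjPolar_apply, map_sum,
    ← sum_range_reflect (fun j => conjPolarCoeff σ a M j * _) M, ← sum_add_distrib]
  refine sum_congr rfl fun m hm => ?_
  have hm : m < M := mem_range.1 hm
  have hsymm (y : L) : (σ ^ M) ((σ ^ (m + 1)).symm y) = (σ ^ (M - 1 - m)) y := by
    have hM : M = M - 1 - m + (m + 1) := by lia
    conv_lhs => rw [hM, pow_add, AlgEquiv.mul_apply, AlgEquiv.apply_symm_apply]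
  have hpow : (σ ^ (M + 1 + m)) x = (σ ^ M) ((σ ^ (m + 1)) x) := by
    rw [add_assoc, add_comm 1, pow_add, AlgEquiv.mul_apply]
  rw [conjPolarCoeff_of_lt (by lia), conjPolarCoeff_add, show M - 1 - (M - 1 - m) = m by lia,
    map_add, hsymm, hpow, map_mul, map_mul]

theorem finrank_ker_conjPolar_le [Finite L]
    (hσ : ∀ x, σ x = x → x ∈ Set.range (algebraMap (ZMod 2) L)) (ha : a (M - 1) ≠ 0) (hM : 0 < M) :
    finrank (ZMod 2) (LinearMap.ker (conjPolar σ a M)) ≤ 2 * M := by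
  refine finrank_le_of_sum_mul_pow_eq_zero σ hσ (2 * M) (conjPolarCoeff σ a M) ?_ _ fun u hu => ?_
  · rw [show 2 * M = M + 1 + (M - 1) by lia, conjPolarCoeff_add]
    exact (map_ne_zero _).2 ha
  · rw [← pow_conjPolar, LinearMap.mem_ker.1 hu, map_zero]

theorem sum_range_eq_sum_range_two_mul {A : Type*} [AddCommMonoid A] {f : ℕ → A} {M : ℕ}
    (hf : ∀ j < 2 * M + 1, Odd j → f j = 0) :
    ∑ j ∈ range (2 * M + 1), f j = ∑ i ∈ range (M + 1), f (2 * i) := by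
  induction M with
  | zero => simp
  | succ M ih =>
    rw [show 2 * (M + 1) + 1 = 2 * M + 1 + 1 + 1 by lia, sum_range_succ, sum_range_succ,
      ih fun j hj => hf j (by lia), hf (2 * M + 1) (by lia) (odd_two_mul_add_one M), add_zero]
    exact (sum_range_succ (fun i => f (2 * i)) (M + 1)).symm

theorem finrank_ker_conjPolar_le_of_even [Finite L]
    (hσ : ∀ x, σ (σ x) = x → x ∈ Set.range (algebraMap (ZMod 2) L)) (hM : Odd M)
    (ha : a (M - 1) ≠ 0) (hodd : ∀ m, Odd m → a m = 0) :
    finrank (ZMod 2) (LinearMap.ker (conjPolar σ a M)) ≤ M := by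
  refine finrank_le_of_sum_mul_pow_eq_zero (σ ^ 2) (by simpa [pow_two] using hσ) M
    (fun i => conjPolarCoeff σ a M (2 * i)) ?_ _ fun u hu => ?_
  · rw [show 2 * M = M + 1 + (M - 1) by grind, conjPolarCoeff_add]
    exact (map_ne_zero _).2 ha
  have hcoeff (j : ℕ) (hj : Odd j) : conjPolarCoeff σ a M j = 0 := by
    unfold conjPolarCoeff
    split_ifs
    · rw [hodd _ (by grind), map_zero]
    · rfl
    · rw [hodd _ (by grind), map_zero]
  calc ∑ i ∈ range (M + 1), conjPolarCoeff σ a M (2 * i) * ((σ ^ 2) ^ i) u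
      = ∑ j ∈ range (2 * M + 1), conjPolarCoeff σ a M j * (σ ^ j) u := by
        rw [sum_range_eq_sum_range_two_mul fun j _ hj => by rw [hcoeff j hj, zero_mul]]
        simp_rw [pow_mul]
    _ = 0 := by rw [← pow_conjPolar, LinearMap.mem_ker.1 hu, map_zero]

/-- A sum of `σ`-conjugates of the terms of `conjForm σ a M`: on the kernel of `conjPolar σ a M` it
is fixed by `σ`, and it is a bilinear form in the conjugates of `x` and of `σ ^ M x`. -/
def conjSum (σ : L ≃ₐ[ZMod 2] L) (a : ℕ → L) (M : ℕ) (x : L) : L :=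
  ∑ m ∈ range M, ∑ s ∈ Ico (M - (m + 1)) M, (σ ^ s) (a m * (x * (σ ^ (m + 1)) x))

theorem apply_conjSum_sub (x : L) :
    σ (conjSum σ a M x) - conjSum σ a M x = (σ ^ M) (x * conjPolar σ a M x) := by
  have : CharP L 2 := charP_of_injective_algebraMap (algebraMap (ZMod 2) L).injective 2
  simp only [conjSum, conjPolar_apply, map_sum, mul_sum, ← sum_sub_distrib]
  refine sum_congr rfl fun m hm => ?_
  have hm : m < M := mem_range.1 hm
  set p := a m * (x * (σ ^ (m + 1)) x) with hp
  have hshift (s : ℕ) : σ ((σ ^ s) p) = (σ ^ (s + 1)) p := by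
    rw [pow_succ', AlgEquiv.mul_apply]
  have hsymm : (σ ^ M) ((σ ^ (m + 1)).symm p) = (σ ^ (M - (m + 1))) p := by
    have hM : M = M - (m + 1) + (m + 1) := by lia
    conv_lhs => rw [hM, pow_add, AlgEquiv.mul_apply, AlgEquiv.apply_symm_apply]
  have hterm : x * ((σ ^ (m + 1)).symm (a m * x) + a m * (σ ^ (m + 1)) x) =
      p - (σ ^ (m + 1)).symm p := by
    have hsymm_mul : (σ ^ (m + 1)).symm p = x * (σ ^ (m + 1)).symm (a m * x) := by
      rw [show p = (σ ^ (m + 1)) x * (a m * x) by rw [hp]; ring, map_mul,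
        AlgEquiv.symm_apply_apply]
    rw [CharTwo.sub_eq_add, hsymm_mul, hp]
    ring
  simp_rw [hshift]
  rw [sum_Ico_sub (fun s => (σ ^ s) p) (by lia), hterm, map_sub, hsymm]

theorem tr_conjSum (hodd : ∀ m, Odd m → a m = 0) (x : L) :
    tr (conjSum σ a M x) = tr (conjForm σ a M x) := by
  simp only [conjSum, conjForm, map_sum]
  refine sum_congr rfl fun m hm => ?_
  have hconj (s : ℕ) (y : L) : tr ((σ ^ s) y) = tr y := Algebra.trace_eq_of_algEquiv _ y
  obtain hm' | hm' := m.even_or_odd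
  · simp_rw [hconj]
    rw [sum_const, Nat.card_Ico, Nat.sub_sub_self (mem_range.1 hm), nsmul_eq_mul,
      ZMod.natCast_eq_one_iff_odd.2 (show Odd m.succ from hm'.add_one), one_mul]
  · simp [hodd m hm']

theorem conjSum_eq_bilinear (ha : ∀ m, M ≤ m → a m = 0) (x : L) :
    conjSum σ a M x = ∑ s ∈ range M, ∑ r ∈ range M,
      (σ ^ s) x * (σ ^ s) (a (M - 1 - s + r)) * (σ ^ r) ((σ ^ M) x) := by
  calc conjSum σ a M x
      = ∑ s ∈ range M, ∑ m ∈ Ico (M - 1 - s) M, (σ ^ s) (a m * (x * (σ ^ (m + 1)) x)) :=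
        sum_comm' fun m s => by simp only [mem_range, mem_Ico]; lia
    _ = ∑ s ∈ range M, ∑ r ∈ range (M - (M - 1 - s)),
          (σ ^ s) x * (σ ^ s) (a (M - 1 - s + r)) * (σ ^ r) ((σ ^ M) x) := by
        refine sum_congr rfl fun s hs => ?_
        have hs : s < M := mem_range.1 hs
        rw [sum_Ico_eq_sum_range]
        refine sum_congr rfl fun r _ => ?_
        have hpow : (σ ^ s) ((σ ^ (M - 1 - s + r + 1)) x) = (σ ^ r) ((σ ^ M) x) := by
          rw [← AlgEquiv.mul_apply, ← AlgEquiv.mul_apply, ← pow_add, ← pow_add,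
            show s + (M - 1 - s + r + 1) = r + M by lia]
        rw [map_mul, map_mul, hpow]
        ring
    _ = _ := by
        refine sum_congr rfl fun s _ => sum_subset (range_mono (Nat.sub_le _ _)) fun r _ hr => ?_
        rw [ha _ (by rw [mem_range] at hr; lia), map_zero, mul_zero, zero_mul]

theorem finrank_ker_conjPolar_ne [Finite L] (hL : Odd (finrank (ZMod 2) L))
    (hσ : ∀ x, σ x = x → x ∈ Set.range (algebraMap (ZMod 2) L)) (hM : Odd M)
    (ha : a (M - 1) ≠ 0) (hodd : ∀ m, Odd m → a m = 0) (hle : ∀ m, M ≤ m → a m = 0)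
    (hker : ∀ u ∈ LinearMap.ker (conjPolar σ a M), tr (conjForm σ a M u) = 0) :
    finrank (ZMod 2) (LinearMap.ker (conjPolar σ a M)) ≠ M := by
  intro hrank
  let N : Matrix (Fin M) (Fin M) L := .of fun s r => (σ ^ (s : ℕ)) (a (M - 1 - s + r))
  have hN_apply (s r : Fin M) : N s r = (σ ^ (s : ℕ)) (a (M - 1 - s + r)) := rfl
  have hN : N.det ≠ 0 := by
    have htri : N.IsLowerTriangular := fun s r hsr => by
      have hsr : (s : ℕ) < r := hsr
      rw [hN_apply, hle _ (by lia), map_zero]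
    rw [Matrix.det_of_isLowerTriangular N htri, prod_ne_zero_iff]
    intro s _
    rw [hN_apply, Nat.sub_add_cancel (by lia)]
    exact (map_ne_zero _).2 ha
  obtain ⟨u, hu, hne⟩ := exists_conjugate_form_ne_zero σ hσ (σ ^ M) hM N hN _ hrank
  have hfixed : σ (conjSum σ a M u) = conjSum σ a M u := by
    rw [← sub_eq_zero, apply_conjSum_sub, LinearMap.mem_ker.1 hu, mul_zero, map_zero]
  obtain ⟨c, hc⟩ := hσ _ hfixed
  have hc0 : c = 0 := by
    have htr := tr_conjSum hodd u (M := M) (σ := σ)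
    rw [hker u hu, ← hc, Algebra.trace_algebraMap, nsmul_eq_mul,
      ZMod.natCast_eq_one_iff_odd.2 hL, one_mul] at htr
    exact htr
  rw [hc0, map_zero, conjSum_eq_bilinear hle] at hc
  refine hne ?_
  exact (hc.trans (by simp only [sum_range, hN_apply])).symm

theorem sq_sum_sgn_tr_conjForm [Fintype L] (hL : Odd (finrank (ZMod 2) L))
    (hσ : ∀ x, σ (σ x) = x → x ∈ Set.range (algebraMap (ZMod 2) L)) (hM : Odd M)
    (ha : a (M - 1) ≠ 0) (hodd : ∀ m, Odd m → a m = 0) (hle : ∀ m, M ≤ m → a m = 0) :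
    (∑ x, sgn (tr (conjForm σ a M x))) ^ 2 = 0 ∨ ∃ r, Odd r ∧ r < M ∧
      (∑ x, sgn (tr (conjForm σ a M x))) ^ 2 = Fintype.card L * 2 ^ r := by
  refine (sq_sum_sgn_of_tr_polar hL tr_conjForm_add).imp_right fun ⟨hker, hr, hsq⟩ =>
    ⟨_, hr, lt_of_le_of_ne (finrank_ker_conjPolar_le_of_even hσ hM ha hodd) ?_, hsq⟩
  exact finrank_ker_conjPolar_ne hL (fun x hx => hσ x (by rw [hx, hx])) hM ha hodd hle hker

theorem sq_sum_sgn_tr_conjForm_add [Fintype L] (hL : Odd (finrank (ZMod 2) L))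
    (hσ : ∀ x, σ x = x → x ∈ Set.range (algebraMap (ZMod 2) L)) (hM : 0 < M)
    (ha : a (M - 1) ≠ 0) (e : L) :
    (∑ x, sgn (tr (e * x + conjForm σ a M x))) ^ 2 = 0 ∨ ∃ r, Odd r ∧ r ≤ 2 * M ∧
      (∑ x, sgn (tr (e * x + conjForm σ a M x))) ^ 2 = Fintype.card L * 2 ^ r := by
  have hQ (x y : L) : tr (e * (x + y) + conjForm σ a M (x + y)) =
      tr (e * x + conjForm σ a M x) + tr (e * y + conjForm σ a M y) +
        tr (conjPolar σ a M x * y) := by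
    rw [mul_add, map_add, map_add, tr_conjForm_add, map_add, map_add]
    ring
  exact (sq_sum_sgn_of_tr_polar hL hQ).imp_right fun ⟨_, hr, hsq⟩ =>
    ⟨_, hr, finrank_ker_conjPolar_le hσ ha hM, hsq⟩

end ConjugationForms

section PowerFunctions

variable {L : Type*} [Field L] [Fintype L] [Algebra (ZMod 2) L]

/-- The Frobenius automorphism `x ↦ x ^ 2`. -/
noncomputable abbrev frob (L : Type*) [Field L] [Fintype L] [Algebra (ZMod 2) L] :
    L ≃ₐ[ZMod 2] L :=
  FiniteField.frobeniusAlgEquivOfAlgebraic (ZMod 2) L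

theorem frob_pow_apply (m : ℕ) (x : L) : (frob L ^ m) x = x ^ 2 ^ m := by
  have h := congrFun (FiniteField.coe_frobeniusAlgEquivOfAlgebraic_iterate (ZMod 2) L m) x
  rwa [ZMod.card, ← AlgEquiv.coe_pow] at h

theorem mem_range_algebraMap_of_frob_pow_apply_eq {m : ℕ}
    (hm : m.Coprime (finrank (ZMod 2) L)) {x : L} (hx : (frob L ^ m) x = x) :
    x ∈ Set.range (algebraMap (ZMod 2) L) := by
  have hperiod (i : ℕ) (hi : (frob L ^ i) x = x) : Function.IsPeriodicPt (frob L) i x := by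
    rwa [AlgEquiv.coe_pow] at hi
  have hcard : (frob L ^ finrank (ZMod 2) L) x = x := by
    rw [← FiniteField.orderOf_frobeniusAlgEquivOfAlgebraic, pow_orderOf_eq_one, AlgEquiv.one_apply]
  have hgcd := (hperiod m hx).gcd (hperiod _ hcard)
  rw [hm] at hgcd
  have hidem : x * x = x := by
    rw [← pow_two, ← pow_one 2, ← frob_pow_apply 1]
    simpa using hgcd.eq
  obtain rfl | rfl := IsIdempotentElem.iff_eq_zero_or_one.1 hidem
  · exact ⟨0, map_zero _⟩
  · exact ⟨1, map_one _⟩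

theorem powF_mul_frob_pow_apply (k : ℕ) (x : L) :
    powF k (x * (frob L ^ k) x) = x * ((frob L ^ k) ^ 3) x := by
  rw [← pow_mul, frob_pow_apply, frob_pow_apply, powF, ← pow_succ', ← pow_succ', ← pow_mul]
  congr 1
  have h : 2 ^ k ≤ 2 ^ (2 * k) := Nat.pow_le_pow_right two_pos (by lia)
  zify [h]
  ring

theorem powG_mul_frob_pow_apply (k : ℕ) (x : L) :
    powG k (x * (frob L ^ k) x) = x * ((frob L ^ k) ^ 5) x := by
  rw [← pow_mul, frob_pow_apply, frob_pow_apply, powG, ← pow_succ', ← pow_succ', ← pow_mul]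
  congr 1
  have h₁ : 2 ^ (3 * k) ≤ 2 ^ (4 * k) := Nat.pow_le_pow_right two_pos (by lia)
  have h₂ : 2 ^ k ≤ 2 ^ (2 * k) := Nat.pow_le_pow_right two_pos (by lia)
  zify [h₁, h₂.trans (Nat.le_add_left _ (2 ^ (4 * k) - 2 ^ (3 * k)))]
  ring

omit [Fintype L] in
theorem bijective_mul_apply [Finite L] (σ : L ≃ₐ[ZMod 2] L)
    (hσ : ∀ x, σ (σ x) = x → x ∈ Set.range (algebraMap (ZMod 2) L)) :
    Function.Bijective fun x : L => x * σ x := by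
  refine Finite.injective_iff_bijective.1 fun x y (hxy : x * σ x = y * σ y) => ?_
  obtain rfl | hy := eq_or_ne y 0
  · simpa using hxy
  have hσy : σ y ≠ 0 := (map_ne_zero σ).2 hy
  have hratio : x / y * σ (x / y) = 1 := by
    rw [map_div₀, div_mul_div_comm, hxy, div_self (mul_ne_zero hy hσy)]
  have hfixed : σ (σ (x / y)) = x / y := by
    refine mul_left_cancel₀ (right_ne_zero_of_mul_eq_one hratio) ?_
    rw [← map_mul, hratio, map_one, mul_comm, hratio]
  obtain ⟨c, hc⟩ := hσ _ hfixed
  obtain rfl | hc0 := eq_or_ne c 0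
  · rw [← hc, map_zero, zero_mul] at hratio
    exact absurd hratio zero_ne_one
  · have hc1 : c = 1 := Fin.eq_one_of_ne_zero c hc0
    rwa [hc1, map_one, eq_comm, div_eq_one_iff_eq hy] at hc

theorem sq_sum_sgn_tr_conj_one_three_five (hL : Odd (finrank (ZMod 2) L)) (σ : L ≃ₐ[ZMod 2] L)
    (hσ : ∀ x, σ (σ x) = x → x ∈ Set.range (algebraMap (ZMod 2) L)) {t : Fin 3 → L} (ht : t ≠ 0)
    {S : ℤ} (hS : S = ∑ x, sgn (tr (t 0 * (x * σ x) + t 1 * (x * (σ ^ 3) x) +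
      t 2 * (x * (σ ^ 5) x)))) :
    S ^ 2 = 0 ∨ S ^ 2 = 2 * Fintype.card L ∨ t 2 ≠ 0 ∧ S ^ 2 = 8 * Fintype.card L := by
  let a : ℕ → L
    | 0 => t 0
    | 2 => t 1
    | 4 => t 2
    | _ => 0
  have key {M : ℕ} (hM : Odd M) (hM5 : M ≤ 5) (ha : a (M - 1) ≠ 0) (h₁ : M ≤ 2 → t 1 = 0)
      (h₂ : M ≤ 4 → t 2 = 0) :
      S ^ 2 = 0 ∨ ∃ r, Odd r ∧ r < M ∧ S ^ 2 = Fintype.card L * 2 ^ r := by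
    have hle (m : ℕ) (hm : M ≤ m) : a m = 0 := by
      have := hM.pos
      unfold a
      split <;> first | rfl | lia
    have hsum : S = ∑ x, sgn (tr (conjForm σ a M x)) := by
      simp_rw [hS, ← conjForm_of_le hle hM5]
      simp [conjForm, sum_range_succ, a, -AlgEquiv.coe_pow]
    rw [hsum]
    refine sq_sum_sgn_tr_conjForm hL hσ hM ha (fun m hm => ?_) hle
    unfold a
    split <;> first | rfl | exact absurd hm (by decide)
  by_cases h₂ : t 2 = 0
  · by_cases h₁ : t 1 = 0
    · have h₀ : t 0 ≠ 0 := fun h₀ => ht (by ext i; fin_cases i <;> assumption)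
      obtain h | ⟨r, hr, hr1, -⟩ :=
        key (M := 1) (by decide) (by decide) h₀ (fun _ => h₁) (fun _ => h₂)
      · exact Or.inl h
      · exact absurd hr (by simp [Nat.lt_one_iff.1 hr1])
    · refine (key (M := 3) (by decide) (by decide) h₁ (by lia) fun _ => h₂).imp_right ?_
      rintro ⟨r, hr, hr3, hsq⟩
      obtain rfl : r = 1 := by grind
      exact Or.inl (by rw [hsq]; ring)
  · refine (key (M := 5) (by decide) le_rfl h₂ (by lia) (by lia)).imp_right ?_
    rintro ⟨r, hr, hr5, hsq⟩
    obtain rfl | rfl : r = 1 ∨ r = 3 := by grind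
    · exact Or.inl (by rw [hsq]; ring)
    · exact Or.inr ⟨h₂, by rw [hsq]; ring⟩

theorem sum_sgn_tr_mul_eq_zero {e : L} (he : e ≠ 0) : ∑ x, sgn (tr (e * x)) = 0 := by
  have hne : tr ∘ₗ LinearMap.mulLeft (ZMod 2) e ≠ 0 := fun h =>
    he (forall_tr_mul_eq_zero_iff.1 fun x => by rw [mul_comm]; exact DFunLike.congr_fun h x)
  exact (sum_sgn_dual (tr ∘ₗ LinearMap.mulLeft (ZMod 2) e)).trans (if_neg hne)

theorem sq_sum_sgn_tr_conj_zero_one_two (hL : Odd (finrank (ZMod 2) L)) (σ : L ≃ₐ[ZMod 2] L)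
    (hσ : ∀ x, σ x = x → x ∈ Set.range (algebraMap (ZMod 2) L)) {t : Fin 3 → L} (ht : t ≠ 0)
    {S : ℤ} (hS : S = ∑ x, sgn (tr (t 0 * x + t 1 * (x * σ x) + t 2 * (x * (σ ^ 2) x)))) :
    S ^ 2 = 0 ∨ S ^ 2 = 2 * Fintype.card L ∨ t 2 ≠ 0 ∧ S ^ 2 = 8 * Fintype.card L := by
  let a : ℕ → L
    | 0 => t 1
    | 1 => t 2
    | _ => 0
  have hform (x : L) : conjForm σ a 2 x = t 1 * (x * σ x) + t 2 * (x * (σ ^ 2) x) := by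
    simp [conjForm, sum_range_succ, a, -AlgEquiv.coe_pow]
  simp_rw [add_assoc, ← hform] at hS
  by_cases h₂ : t 2 = 0
  · have hle (m : ℕ) (hm : 1 ≤ m) : a m = 0 := by
      unfold a
      split <;> first | rfl | assumption | lia
    simp_rw [conjForm_of_le hle one_le_two] at hS
    by_cases h₁ : t 1 = 0
    · have h₀ : t 0 ≠ 0 := fun h₀ => ht (by ext i; fin_cases i <;> assumption)
      refine Or.inl ?_
      simp [hS, conjForm, a, h₁, sum_sgn_tr_mul_eq_zero h₀]
    · rw [hS]
      refine (sq_sum_sgn_tr_conjForm_add hL hσ one_pos h₁ (t 0)).imp_right ?_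
      rintro ⟨r, hr, hr2, hsq⟩
      obtain rfl : r = 1 := by grind
      exact Or.inl (by rw [hsq]; ring)
  · rw [hS]
    refine (sq_sum_sgn_tr_conjForm_add hL hσ two_pos h₂ (t 0)).imp_right ?_
    rintro ⟨r, hr, hr4, hsq⟩
    obtain rfl | rfl : r = 1 ∨ r = 3 := by grind
    · exact Or.inl (by rw [hsq]; ring)
    · exact Or.inr ⟨h₂, by rw [hsq]; ring⟩

/-- The vectors `(x, f x, g x)` whose coordinates are the columns of the parity-check matrix,
together with the zero vector at `x = 0` when `f 0 = g 0 = 0`. -/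
def column (f g : L → L) (x : L) : Fin 3 → L := ![x, f x, g x]

theorem walsh_column (f g : L → L) (t : Fin 3 → L) :
    walsh (column f g) t = fourier f g (t 0) (t 1) (t 2) := by
  simp [walsh, column, fourier, dotProduct, Fin.sum_univ_three, sgn_apply]

/-- The Walsh spectrum common to the triple-error-correcting codes under consideration: three
squared values in general, and two on the dual of the code given by `x` and `f x` alone. -/
structure HasBCHSpectrum (f g : L → L) : Prop where
  map_zero_fst : f 0 = 0
  map_zero_snd : g 0 = 0
  sq_walsh : ∀ t ≠ 0, walsh (column f g) t ^ 2 = 0 ∨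
    walsh (column f g) t ^ 2 = 2 * Fintype.card L ∨
    t 2 ≠ 0 ∧ walsh (column f g) t ^ 2 = 8 * Fintype.card L

theorem hasBCHSpectrum_powF_powG (hL : Odd (finrank (ZMod 2) L)) {k : ℕ}
    (hk : k.Coprime (finrank (ZMod 2) L)) : HasBCHSpectrum (L := L) (powF k) (powG k) where
  map_zero_fst := zero_pow (Nat.succ_ne_zero _)
  map_zero_snd := zero_pow (Nat.succ_ne_zero _)
  sq_walsh t ht := by
    have hσ (x : L) (hx : (frob L ^ k) ((frob L ^ k) x) = x) :
        x ∈ Set.range (algebraMap (ZMod 2) L) :=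
      mem_range_algebraMap_of_frob_pow_apply_eq
        (Nat.Coprime.mul_left (Nat.coprime_two_left.2 hL) hk) (by
          rwa [two_mul, pow_add, AlgEquiv.mul_apply])
    refine sq_sum_sgn_tr_conj_one_three_five hL (frob L ^ k) hσ ht ?_
    rw [walsh_column, fourier, ← (bijective_mul_apply _ hσ).sum_comp]
    simp only [powF_mul_frob_pow_apply, powG_mul_frob_pow_apply, sgn_apply]

theorem hasBCHSpectrum_pow_three_pow_five (hL : Odd (finrank (ZMod 2) L)) :
    HasBCHSpectrum (L := L) (· ^ 3) (· ^ 5) where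
  map_zero_fst := zero_pow (by decide)
  map_zero_snd := zero_pow (by decide)
  sq_walsh t ht := by
    refine sq_sum_sgn_tr_conj_zero_one_two hL (frob L) (fun x hx =>
      mem_range_algebraMap_of_frob_pow_apply_eq (Nat.coprime_one_left _) (by rwa [pow_one])) ht ?_
    simp [walsh_column, fourier, sgn_apply, frob_pow_apply, ← pow_succ', -AlgEquiv.coe_pow]

end PowerFunctions

section ZeroSumTuples

theorem sum_sum_sgn_fin_succ (F : ℤ → ℤ) (m : ℕ) :
    ∑ s : Fin (m + 1) → ZMod 2, F (∑ i, sgn (s i)) =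
      ∑ s : Fin m → ZMod 2, (F (∑ i, sgn (s i) + 1) + F (∑ i, sgn (s i) - 1)) := by
  have hbit (G : ZMod 2 → ℤ) : ∑ z, G z = G 0 + G 1 := Fin.sum_univ_two G
  rw [← (Fin.consEquiv fun _ : Fin (m + 1) => ZMod 2).sum_comp, Fintype.sum_prod_type_right]
  refine sum_congr rfl fun s _ => ?_
  simp only [Fin.consEquiv_apply, Fin.sum_univ_succ, Fin.cons_zero, Fin.cons_succ]
  rw [hbit, sgn_zero, sgn_one]
  congr 2 <;> ring

theorem sum_sum_sgn_sq (m : ℕ) :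
    ∑ s : Fin m → ZMod 2, (∑ i, sgn (s i)) ^ 2 = 2 ^ m * m := by
  induction m with
  | zero => simp
  | succ m ih =>
    have hstep (y : ℤ) : (y + 1) ^ 2 + (y - 1) ^ 2 = 2 * y ^ 2 + 2 := by ring
    rw [sum_sum_sgn_fin_succ (· ^ 2)]
    simp only [hstep, sum_add_distrib, ← mul_sum, ih, sum_const, card_univ, Fintype.card_pi_const,
      ZMod.card, nsmul_eq_mul]
    push_cast
    ring

theorem sum_sum_sgn_pow_four (m : ℕ) :
    ∑ s : Fin m → ZMod 2, (∑ i, sgn (s i)) ^ 4 = 2 ^ m * (3 * m ^ 2 - 2 * m) := by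
  induction m with
  | zero => simp
  | succ m ih =>
    have hstep (y : ℤ) : (y + 1) ^ 4 + (y - 1) ^ 4 = 2 * y ^ 4 + 12 * y ^ 2 + 2 := by ring
    rw [sum_sum_sgn_fin_succ (· ^ 4)]
    simp only [hstep, sum_add_distrib, ← mul_sum, ih, sum_sum_sgn_sq, sum_const, card_univ,
      Fintype.card_pi_const, ZMod.card, nsmul_eq_mul]
    push_cast
    ring

theorem sum_sum_sgn_pow_six (m : ℕ) : ∑ s : Fin m → ZMod 2, (∑ i, sgn (s i)) ^ 6 =
    2 ^ m * (15 * m ^ 3 - 30 * m ^ 2 + 16 * m) := by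
  induction m with
  | zero => simp
  | succ m ih =>
    have hstep (y : ℤ) :
        (y + 1) ^ 6 + (y - 1) ^ 6 = 2 * y ^ 6 + 30 * y ^ 4 + 30 * y ^ 2 + 2 := by ring
    rw [sum_sum_sgn_fin_succ (· ^ 6)]
    simp only [hstep, sum_add_distrib, ← mul_sum, ih, sum_sum_sgn_sq, sum_sum_sgn_pow_four,
      sum_const, card_univ, Fintype.card_pi_const, ZMod.card, nsmul_eq_mul]
    push_cast
    ring

variable {X : Type*}

/-- The standard basis vector of `X → ZMod 2` at `x`. A sum of such vectors records the parities
with which the points occur. -/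
noncomputable def point (x : X) : X → ZMod 2 := open Classical in Pi.single x 1

theorem sum_point_apply_smul [Fintype X] {V : Type*} [AddCommGroup V] [Module (ZMod 2) V]
    (φ : X → V) {ι : Type*} (s : Finset ι) (x : ι → X) :
    ∑ y, (∑ i ∈ s, point (x i)) y • φ y = ∑ i ∈ s, φ (x i) := by
  classical
  simp only [Finset.sum_apply, sum_smul]
  rw [sum_comm]
  refine sum_congr rfl fun i _ => ?_
  simp [point, Pi.single_apply, ite_smul]

theorem zeroSumTuples_point_subset [Fintype X] {V : Type*} [AddCommGroup V] [Module (ZMod 2) V]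
    (φ : X → V) (j : ℕ) : zeroSumTuples (point (X := X)) j ⊆ zeroSumTuples φ j := by
  intro x hx
  rw [mem_zeroSumTuples] at hx ⊢
  rw [← sum_point_apply_smul, hx]
  simp

theorem sum_sum_sgn_pow_card [Fintype X] (j : ℕ) :
    ∑ s : Fin (Fintype.card X) → ZMod 2, (∑ i, sgn (s i)) ^ j =
      2 ^ Fintype.card X * #(zeroSumTuples (point (X := X)) j) := by
  classical
  have hwalsh (s : X → ZMod 2) : walsh point s = ∑ x, sgn (s x) := by
    simp [walsh, point, dotProduct_single]
  have hsum := sum_walsh_pow (point (X := X)) j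
  rw [Fintype.card_fun, ZMod.card, Nat.cast_pow, Nat.cast_ofNat] at hsum
  rw [← hsum, ← ((Fintype.equivFin X).arrowCongr (Equiv.refl (ZMod 2))).sum_comp]
  refine sum_congr rfl fun s _ => ?_
  rw [hwalsh, ← (Fintype.equivFin X).symm.sum_comp]
  rfl

variable (X) [Fintype X]

theorem card_zeroSumTuples_point_two :
    (#(zeroSumTuples (point (X := X)) 2) : ℤ) = Fintype.card X :=
  mul_left_cancel₀ (by positivity) ((sum_sum_sgn_pow_card 2).symm.trans (sum_sum_sgn_sq _))

theorem card_zeroSumTuples_point_four : (#(zeroSumTuples (point (X := X)) 4) : ℤ) =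
    3 * Fintype.card X ^ 2 - 2 * Fintype.card X :=
  mul_left_cancel₀ (by positivity) ((sum_sum_sgn_pow_card 4).symm.trans (sum_sum_sgn_pow_four _))

theorem card_zeroSumTuples_point_six : (#(zeroSumTuples (point (X := X)) 6) : ℤ) =
    15 * Fintype.card X ^ 3 - 30 * Fintype.card X ^ 2 + 16 * Fintype.card X :=
  mul_left_cancel₀ (by positivity) ((sum_sum_sgn_pow_card 6).symm.trans (sum_sum_sgn_pow_six _))

end ZeroSumTuples

section Moments

theorem zeroSumTuples_two_of_injective {X V : Type*} [Fintype X] [AddCommGroup V]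
    [Module (ZMod 2) V] {φ : X → V} (hφ : Function.Injective φ) :
    zeroSumTuples φ 2 = zeroSumTuples point 2 := by
  refine (Subset.antisymm (zeroSumTuples_point_subset φ 2) fun x hx => ?_).symm
  rw [mem_zeroSumTuples, Fin.sum_univ_two] at hx ⊢
  have h : x 0 = x 1 := hφ (by rw [eq_neg_of_add_eq_zero_left hx, ZModModule.neg_eq_self])
  rw [h, ZModModule.add_self]

theorem exists_tuple_sum_eq {ι : Type*} {X : Type*} {s : Finset ι} {m : ℕ} (hs : #s ≤ m)
    (x : ι → X) (x₀ : X) : ∃ y : Fin m → X, ∀ {V : Type*} [AddCommMonoid V] (φ : X → V),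
      ∑ k, φ (y k) = ∑ i ∈ s, φ (x i) + (m - #s) • φ x₀ := by
  obtain ⟨r, rfl⟩ := Nat.exists_eq_add_of_le hs
  refine ⟨Fin.append (fun k => x (s.equivFin.symm k)) fun _ => x₀, fun φ => ?_⟩
  simp only [Fin.sum_univ_add, Fin.append_left, Fin.append_right, sum_const, card_univ,
    Fintype.card_fin, Nat.add_sub_cancel_left]
  rw [s.equivFin.symm.sum_comp fun i : s => φ (x i), sum_coe_sort s fun i => φ (x i)]

variable {L : Type*} [Field L] [Fintype L] [Algebra (ZMod 2) L] {f g : L → L}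

theorem walsh_pair (f g : L → L) (t : Fin 2 → L) :
    walsh (fun x => ![x, f x]) t = walsh (column f g) ![t 0, t 1, 0] := by
  simp [walsh, column, dotProduct, Fin.sum_univ_two, Fin.sum_univ_three]

omit [Algebra (ZMod 2) L] in
theorem zeroSumTuples_column_subset (f g : L → L) (j : ℕ) :
    zeroSumTuples (column f g) j ⊆ zeroSumTuples (fun x => ![x, f x]) j := by
  intro x hx
  rw [mem_zeroSumTuples] at hx ⊢
  ext i
  fin_cases i
  · simpa [column] using congrFun hx 0
  · simpa [column] using congrFun hx 1

namespace HasBCHSpectrum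

theorem card_zeroSumTuples_pair_four (h : HasBCHSpectrum f g) :
    (#(zeroSumTuples (fun x => ![x, f x]) 4) : ℤ) =
      3 * Fintype.card L ^ 2 - 2 * Fintype.card L := by
  classical
  set q : ℤ := (Fintype.card L : ℤ) with hq
  set W : (Fin 2 → L) → ℤ := walsh fun x => ![x, f x] with hW
  have hinj : Function.Injective fun x => ![x, f x] := fun x y hxy => congrFun hxy 0
  have hroot (t : Fin 2 → L) (ht : t ≠ 0) : W t ^ 4 - 2 * q * W t ^ 2 = 0 := by
    have hne : ![t 0, t 1, 0] ≠ 0 := by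
      contrapose! ht
      ext i
      fin_cases i
      · exact congrFun ht 0
      · exact congrFun ht 1
    have hsq : W t ^ 2 = 0 ∨ W t ^ 2 = 2 * q := by
      rw [hW, walsh_pair f g]
      exact (h.sq_walsh _ hne).imp_right (Or.resolve_right · fun h' => h'.1 rfl)
    grind
  have hsum := Fintype.sum_eq_single 0 hroot
  rw [sum_sub_distrib, ← mul_sum, sum_walsh_pow, sum_walsh_pow,
    zeroSumTuples_two_of_injective hinj, card_zeroSumTuples_point_two, hW, walsh_zero,
    Fintype.card_pi_const, Nat.cast_pow, ← hq] at hsum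
  have hq0 : q ^ 2 ≠ 0 := by positivity
  refine mul_left_cancel₀ hq0 ?_
  linear_combination hsum

theorem card_zeroSumTuples_column_four (h : HasBCHSpectrum f g) :
    (#(zeroSumTuples (column f g) 4) : ℤ) = 3 * Fintype.card L ^ 2 - 2 * Fintype.card L := by
  refine le_antisymm ?_ ?_
  · rw [← h.card_zeroSumTuples_pair_four]
    exact_mod_cast card_le_card (zeroSumTuples_column_subset f g 4)
  · rw [← card_zeroSumTuples_point_four]
    exact_mod_cast card_le_card (zeroSumTuples_point_subset (column f g) 4)

theorem card_zeroSumTuples_column_six (h : HasBCHSpectrum f g) :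
    (#(zeroSumTuples (column f g) 6) : ℤ) =
      15 * Fintype.card L ^ 3 - 30 * Fintype.card L ^ 2 + 16 * Fintype.card L := by
  classical
  set q : ℤ := (Fintype.card L : ℤ) with hq
  set W : (Fin 3 → L) → ℤ := walsh (column f g) with hW
  have hinj : Function.Injective (column f g) := fun x y hxy => congrFun hxy 0
  have hroot (t : Fin 3 → L) (ht : t ≠ 0) :
      W t ^ 6 - 10 * q * W t ^ 4 + 16 * q ^ 2 * W t ^ 2 = 0 := by
    have hsq := h.sq_walsh t ht
    rw [← hW, ← hq] at hsq
    grind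
  have hsum := Fintype.sum_eq_single 0 hroot
  rw [sum_add_distrib, sum_sub_distrib, ← mul_sum, ← mul_sum, sum_walsh_pow, sum_walsh_pow,
    sum_walsh_pow, zeroSumTuples_two_of_injective hinj, card_zeroSumTuples_point_two,
    h.card_zeroSumTuples_column_four, hW, walsh_zero, Fintype.card_pi_const, Nat.cast_pow,
    ← hq] at hsum
  have hq0 : q ^ 3 ≠ 0 := by positivity
  refine mul_left_cancel₀ hq0 ?_
  linear_combination hsum

theorem zeroSumTuples_column_six (h : HasBCHSpectrum f g) :
    zeroSumTuples (column f g) 6 = zeroSumTuples point 6 := by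
  refine (eq_of_subset_of_card_le (zeroSumTuples_point_subset _ 6) (le_of_eq ?_)).symm
  zify
  rw [h.card_zeroSumTuples_column_six, card_zeroSumTuples_point_six]

theorem column_zero (h : HasBCHSpectrum f g) : column f g 0 = 0 := by
  simp [column, h.map_zero_fst, h.map_zero_snd]

theorem sum_column_eq_zero_iff (h : HasBCHSpectrum f g) {ι : Type*} {s : Finset ι}
    (hs : #s ≤ 6) (x : ι → L) :
    ∑ i ∈ s, column f g (x i) = 0 ↔ ∀ y ≠ 0, (∑ i ∈ s, point (x i)) y = 0 := by
  constructor
  · intro hsum y hy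
    obtain ⟨x', hx'⟩ := exists_tuple_sum_eq hs x 0
    have hmem : x' ∈ zeroSumTuples (column f g) 6 := by
      rw [mem_zeroSumTuples, hx', hsum, h.column_zero, smul_zero, add_zero]
    rw [h.zeroSumTuples_column_six, mem_zeroSumTuples, hx'] at hmem
    simpa [point, hy] using congrFun hmem y
  · intro hpoint
    rw [← sum_point_apply_smul]
    refine sum_eq_zero fun y _ => ?_
    obtain rfl | hy := eq_or_ne y 0
    · rw [h.column_zero, smul_zero]
    · rw [hpoint y hy, zero_smul]

theorem sum_walsh_column_pow_eq {f' g' : L → L} (h : HasBCHSpectrum f g)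
    (h' : HasBCHSpectrum f' g') {j : ℕ} (hj : j ≤ 6) :
    ∑ t, walsh (column f g) t ^ j = ∑ t, walsh (column f' g') t ^ j := by
  classical
  have htuples : zeroSumTuples (column f g) j = zeroSumTuples (column f' g') j := by
    ext x
    have hcard : #(univ : Finset (Fin j)) ≤ 6 := by simpa using hj
    rw [mem_zeroSumTuples, mem_zeroSumTuples, h.sum_column_eq_zero_iff hcard,
      h'.sum_column_eq_zero_iff hcard]
  rw [sum_walsh_pow, sum_walsh_pow, htuples]

end HasBCHSpectrum

end Moments

section Distribution

theorem sum_card_filter_eq_mul {R α : Type*} [Semiring R] [DecidableEq R] [Fintype α]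
    {S : Finset R} {u : α → R} (hu : ∀ a, u a ∈ S) (F : R → R) :
    ∑ z ∈ S, (#{a | u a = z} : R) * F z = ∑ a, F (u a) := by
  rw [← sum_fiberwise_of_maps_to fun a _ => hu a]
  refine sum_congr rfl fun z _ => ?_
  rw [← nsmul_eq_mul, ← sum_const]
  exact sum_congr rfl fun a ha => by rw [(mem_filter.1 ha).2]

theorem sum_comp_eq_of_sum_pow_eq {R α β : Type*} [CommRing R] [IsDomain R] [Fintype α]
    [Fintype β] {S : Finset R} {u : α → R} {v : β → R} (hu : ∀ a, u a ∈ S) (hv : ∀ b, v b ∈ S)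
    (hpow : ∀ j < #S, ∑ a, u a ^ j = ∑ b, v b ^ j) (F : R → R) :
    ∑ a, F (u a) = ∑ b, F (v b) := by
  classical
  let z (i : Fin #S) : R := S.equivFin.symm i
  have hz : Function.Injective z := Subtype.val_injective.comp S.equivFin.symm.injective
  let m (i : Fin #S) : R := (#{a | u a = z i} : R) - #{b | v b = z i}
  have hdiff (G : R → R) : ∑ i, m i * G (z i) = ∑ a, G (u a) - ∑ b, G (v b) := by
    rw [← sum_card_filter_eq_mul hu, ← sum_card_filter_eq_mul hv, ← sum_sub_distrib,
      ← sum_coe_sort S, ← S.equivFin.symm.sum_comp]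
    simp only [m, z, sub_mul]
  have hm : m = 0 := Matrix.eq_zero_of_forall_pow_sum_mul_pow_eq_zero hz fun j => by
    rw [hdiff (· ^ (j : ℕ)), hpow j j.2, sub_self]
  rw [← sub_eq_zero, ← hdiff, hm]
  simp

namespace HasBCHSpectrum

variable {L : Type*} [Field L] [Fintype L] [Algebra (ZMod 2) L] {f g f' g' : L → L}

theorem walsh_mem (h : HasBCHSpectrum f g) {n : ℕ} (hn : Odd n)
    (hcard : Fintype.card L = 2 ^ n) {t : Fin 3 → L} (ht : t ≠ 0) :
    walsh (column f g) t ∈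
      ({0, 2 ^ ((n + 1) / 2), -2 ^ ((n + 1) / 2), 2 ^ ((n + 3) / 2), -2 ^ ((n + 3) / 2)} :
        Set ℤ) := by
  obtain ⟨m, rfl⟩ := hn
  have h₁ : (2 * m + 1 + 1) / 2 = m + 1 := by lia
  have h₃ : (2 * m + 1 + 3) / 2 = m + 2 := by lia
  have hsq : walsh (column f g) t = 0 ∨
      walsh (column f g) t ^ 2 = (2 ^ (m + 1)) ^ 2 ∨
      walsh (column f g) t ^ 2 = (2 ^ (m + 2)) ^ 2 := by
    refine (h.sq_walsh t ht).imp (pow_eq_zero_iff two_ne_zero).1 (Or.imp ?_ ?_)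
    · intro hq
      rw [hq, hcard]
      push_cast
      ring
    · rintro ⟨-, hq⟩
      rw [hq, hcard]
      push_cast
      ring
  rw [h₁, h₃]
  simp only [sq_eq_sq_iff_eq_or_eq_neg] at hsq
  simpa only [Set.mem_insert_iff, Set.mem_singleton_iff, or_assoc] using hsq

theorem walsh_ne_card (h : HasBCHSpectrum f g) (hL : 8 < Fintype.card L) {t : Fin 3 → L}
    (ht : t ≠ 0) : walsh (column f g) t ≠ Fintype.card L := by
  intro hW
  have hsq := h.sq_walsh t ht
  rw [hW] at hsq
  have hq : (8 : ℤ) < Fintype.card L := by exact_mod_cast hL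
  rcases hsq with hsq | hsq | ⟨-, hsq⟩ <;> nlinarith [hq]

theorem sum_comp_walsh_eq (h : HasBCHSpectrum f g) (h' : HasBCHSpectrum f' g')
    (hL : Odd (finrank (ZMod 2) L)) (F : ℤ → ℤ) :
    ∑ t, F (walsh (column f g) t) = ∑ t, F (walsh (column f' g') t) := by
  classical
  set n := finrank (ZMod 2) L
  have hcard : Fintype.card L = 2 ^ n := by
    rw [card_eq_pow_finrank (K := ZMod 2), ZMod.card]
  let S : Finset ℤ := {2 ^ n, 0, 2 ^ ((n + 1) / 2), -2 ^ ((n + 1) / 2), 2 ^ ((n + 3) / 2),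
    -2 ^ ((n + 3) / 2)}
  have hmem {f g : L → L} (h : HasBCHSpectrum f g) (t : Fin 3 → L) :
      walsh (column f g) t ∈ S := by
    obtain rfl | ht := eq_or_ne t 0
    · simp [S, walsh_zero, hcard]
    · exact mem_insert_of_mem (by simpa using h.walsh_mem hL hcard ht)
  have hS : #S ≤ 6 := card_le_six
  exact sum_comp_eq_of_sum_pow_eq (hmem h) (hmem h')
    (fun j hj => h.sum_walsh_column_pow_eq h' (hj.le.trans hS)) F

end HasBCHSpectrum

end Distribution

section MacWilliams

open Polynomial

variable {ι : Type*} [Fintype ι]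

/-- The Krawtchouk number of `N` and `w` at weight `(N - z) / 2`: the coefficient of `X ^ w` in
`(1 + X) ^ ((N + z) / 2) * (1 - X) ^ ((N - z) / 2)`. The argument `z` is the difference between
the numbers of zeros and ones of a word, which is what a Walsh transform measures. -/
noncomputable def krawtchouk (N w : ℕ) (z : ℤ) : ℤ :=
  ((1 + X : ℤ[X]) ^ ((N + z) / 2).toNat * (1 - X) ^ ((N - z) / 2).toNat).coeff w

theorem sum_sgn_mul_X_pow_hammingNorm [DecidableEq ι] (c : ι → ZMod 2) :
    ∑ u : ι → ZMod 2, C (sgn (u ⬝ᵥ c)) * X ^ hammingNorm u = ∏ x, (1 + C (sgn (c x)) * X) := by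
  have hfactor (x : ι) : 1 + C (sgn (c x)) * X =
      ∑ z : ZMod 2, C (sgn (z * c x)) * X ^ (if z ≠ 0 then 1 else 0) := by
    have htwo (F : ZMod 2 → ℤ[X]) : ∑ z, F z = F 0 + F 1 := Fin.sum_univ_two F
    simp [htwo]
  simp_rw [hfactor]
  rw [prod_univ_sum, Fintype.piFinset_univ]
  refine sum_congr rfl fun u _ => ?_
  rw [prod_mul_distrib, prod_pow_eq_pow_sum, hammingNorm, card_filter, dotProduct, sgn_sum,
    map_prod]

theorem sum_sgn_eq_card_sub (c : ι → ZMod 2) :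
    ∑ x, sgn (c x) = #{x | c x = 0} - #{x | c x ≠ 0} := by
  rw [← sum_filter_add_sum_filter_not univ (c · = 0)]
  have h₀ : ∑ x with c x = 0, sgn (c x) = #{x | c x = 0} := by
    rw [sum_congr rfl fun x hx => by rw [(mem_filter.1 hx).2, sgn_zero]]
    simp
  have h₁ : ∑ x with c x ≠ 0, sgn (c x) = -#{x | c x ≠ 0} := by
    rw [sum_congr rfl fun x hx => sgn_of_ne_zero (mem_filter.1 hx).2]
    simp
  rw [h₀, h₁, sub_eq_add_neg]

theorem sum_sgn_dotProduct_hammingNorm_eq [DecidableEq ι] (w : ℕ) (c : ι → ZMod 2) :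
    ∑ u : ι → ZMod 2 with hammingNorm u = w, sgn (u ⬝ᵥ c) =
      krawtchouk (Fintype.card ι) w (∑ x, sgn (c x)) := by
  have hcard : (#{x | c x = 0} : ℤ) + #{x | c x ≠ 0} = Fintype.card ι := by
    exact_mod_cast card_filter_add_card_filter_not _
  have hprod : ∏ x, (1 + C (sgn (c x)) * X) =
      (1 + X : ℤ[X]) ^ #{x | c x = 0} * (1 - X) ^ #{x | c x ≠ 0} := by
    rw [← prod_const, ← prod_const, ← prod_filter_mul_prod_filter_not univ (c · = 0)]
    congr 1
    · refine prod_congr rfl fun x hx => ?_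
      simp [(mem_filter.1 hx).2]
    · refine prod_congr rfl fun x hx => ?_
      simp [sgn_of_ne_zero (mem_filter.1 hx).2, sub_eq_add_neg]
  have h₀ : ((Fintype.card ι + ∑ x, sgn (c x)) / 2).toNat = #{x | c x = 0} := by
    rw [sum_sgn_eq_card_sub]
    lia
  have h₁ : ((Fintype.card ι - ∑ x, sgn (c x)) / 2).toNat = #{x | c x ≠ 0} := by
    rw [sum_sgn_eq_card_sub]
    lia
  rw [krawtchouk, h₀, h₁, ← hprod, ← sum_sgn_mul_X_pow_hammingNorm, finsetSum_coeff, sum_filter]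
  simp [coeff_X_pow, eq_comm]

end MacWilliams

section Code

theorem sum_eq_add_sum_units {G₀ M : Type*} [GroupWithZero G₀] [Fintype G₀] [DecidableEq G₀]
    [AddCommMonoid M] (h : G₀ → M) : ∑ x, h x = h 0 + ∑ x : G₀ˣ, h x := by
  rw [← add_sum_erase univ h (mem_univ 0), ← filter_ne', ← sum_subtype_eq_sum_filter,
    subtype_univ, ← unitsEquivNeZero.sum_comp]
  simp

variable {L : Type*} [Field L] [Fintype L] [DecidableEq L] [Algebra (ZMod 2) L]

variable {n : ℕ} (B : Basis (Fin n) (ZMod 2) L) {f g : L → L}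

theorem mem_code_iff {u : Lˣ → ZMod 2} :
    u ∈ code B f g ↔ ∑ x : Lˣ, u x • column f g x = 0 := by
  have hcoord (i : Fin 3) : (∀ j, (parityCheck B f g *ᵥ u) (i, j) = 0) ↔
      (∑ x : Lˣ, u x • column f g x) i = 0 := by
    rw [← B.repr.map_eq_zero_iff, Finsupp.ext_iff]
    simp [parityCheck, mulVec, dotProduct, column, Finset.sum_apply, mul_comm, -smul_cons]
  rw [code, LinearMap.mem_ker, mulVecLin_apply, funext_iff, Prod.forall, funext_iff]
  exact forall_congr' hcoord

theorem mem_code_iff_sum_filter {u : Lˣ → ZMod 2} :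
    u ∈ code B f g ↔ ∑ x : Lˣ with u x ≠ 0, column f g x = 0 := by
  have hterm (x : Lˣ) : u x • column f g x = if u x ≠ 0 then column f g x else 0 := by
    split_ifs with hx
    · rw [show u x = 1 from Fin.eq_one_of_ne_zero _ hx, one_smul]
    · rw [not_not.1 hx, zero_smul]
  rw [mem_code_iff, sum_filter]
  simp_rw [hterm]

theorem card_mul_ncard_code_inter (U : Finset (Lˣ → ZMod 2)) :
    Fintype.card (Fin 3 → L) * (Set.ncard {u | u ∈ code B f g ∧ u ∈ U} : ℤ) =
      ∑ t, ∑ u ∈ U, sgn (u ⬝ᵥ fun x : Lˣ => tr (t ⬝ᵥ column f g x)) := by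
  classical
  have hpair (t : Fin 3 → L) (u : Lˣ → ZMod 2) :
      u ⬝ᵥ (fun x : Lˣ => tr (t ⬝ᵥ column f g x)) =
        tr (t ⬝ᵥ ∑ x : Lˣ, u x • column f g x) := by
    rw [dotProduct_sum, map_sum, dotProduct]
    simp_rw [dotProduct_smul, map_smul, smul_eq_mul]
  simp_rw [hpair]
  rw [sum_comm]
  simp_rw [sum_sgn_tr_dotProduct, ← mem_code_iff B]
  rw [← sum_filter, sum_const, nsmul_eq_mul, mul_comm, ← Set.ncard_coe_finset]
  simp [and_comm]

namespace HasBCHSpectrum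

theorem seven_le_hammingNorm (h : HasBCHSpectrum f g) {u : Lˣ → ZMod 2}
    (hu : u ∈ code B f g) (hu₀ : u ≠ 0) : 7 ≤ hammingNorm u := by
  by_contra! hlt
  obtain ⟨y, hy : u y ≠ 0⟩ := Function.ne_iff.1 hu₀
  have hpoint := (h.sum_column_eq_zero_iff (Nat.le_of_lt_succ hlt) _).1
    ((mem_code_iff_sum_filter B).1 hu) y y.ne_zero
  simp [point, Finset.sum_apply, Pi.single_apply, Units.val_inj, hy] at hpoint

theorem sum_units_sgn (h : HasBCHSpectrum f g) (t : Fin 3 → L) :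
    ∑ x : Lˣ, sgn (tr (t ⬝ᵥ column f g x)) = walsh (column f g) t - 1 := by
  rw [walsh, sum_eq_add_sum_units fun x : L => sgn (tr (t ⬝ᵥ column f g x)), h.column_zero]
  simp

theorem weightCount_eq (h : HasBCHSpectrum f g) {f' g' : L → L} (h' : HasBCHSpectrum f' g')
    (hL : Odd (finrank (ZMod 2) L)) (w : ℕ) :
    weightCount (code B f g) w = weightCount (code B f' g') w := by
  have hcount {f g : L → L} (h : HasBCHSpectrum f g) :
      Fintype.card (Fin 3 → L) * (weightCount (code B f g) w : ℤ) =
        ∑ t, krawtchouk (Fintype.card Lˣ) w (walsh (column f g) t - 1) := by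
    simp_rw [← h.sum_units_sgn, ← sum_sgn_dotProduct_hammingNorm_eq]
    rw [← card_mul_ncard_code_inter B]
    simp [weightCount]
  have heq := h.sum_comp_walsh_eq h' hL fun z => krawtchouk (Fintype.card Lˣ) w (z - 1)
  rw [← hcount h, ← hcount h'] at heq
  exact_mod_cast mul_left_cancel₀ (by positivity) heq

theorem finrank_code (h : HasBCHSpectrum f g) (hL : 8 < Fintype.card L) :
    3 * finrank (ZMod 2) L + finrank (ZMod 2) (code B f g) = Fintype.card Lˣ := by
  classical
  have hzero (t : Fin 3 → L) (ht : t ≠ 0) :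
      ∑ u, sgn (u ⬝ᵥ fun x : Lˣ => tr (t ⬝ᵥ column f g x)) = 0 := by
    have hne : (fun x : Lˣ => tr (t ⬝ᵥ column f g x)) ≠ 0 := by
      intro htr
      refine h.walsh_ne_card hL ht ?_
      have hsum := h.sum_units_sgn t
      simp_rw [congrFun htr _] at hsum
      simp only [Pi.zero_apply, sgn_zero, sum_const, card_univ, nsmul_one] at hsum
      have hcard := Fintype.card_units L
      lia
    simpa [hne] using sum_sgn_tr_dotProduct fun x : Lˣ => tr (t ⬝ᵥ column f g x)
  have hncard : {u | u ∈ code B f g ∧ u ∈ (univ : Finset (Lˣ → ZMod 2))}.ncard =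
      2 ^ finrank (ZMod 2) (code B f g) := by
    have hcard := natCard_eq_pow_finrank (K := ZMod 2) (V := code B f g)
    rw [Nat.card_zmod] at hcard
    simp only [mem_univ, and_true, ← hcard]
    exact (Nat.card_coe_set_eq _).symm
  have hcount := card_mul_ncard_code_inter B (f := f) (g := g) univ
  rw [Fintype.sum_eq_single 0 hzero, hncard, Fintype.card_pi_const,
    card_eq_pow_finrank (K := ZMod 2) (V := L), ZMod.card] at hcount
  simp only [zero_dotProduct, map_zero, dotProduct_zero', sgn_zero, sum_const, card_univ,
    Fintype.card_fun, ZMod.card, nsmul_one] at hcount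
  have hpow : 2 ^ (3 * finrank (ZMod 2) L + finrank (ZMod 2) (code B f g)) =
      2 ^ Fintype.card Lˣ := by
    rw [pow_add, mul_comm 3, pow_mul]
    exact_mod_cast hcount
  exact Nat.pow_right_injective le_rfl hpow

end HasBCHSpectrum

end Code

section MinimumDistance

theorem sum_mul_eq_zero_of_three_le_card {ι : Type*} [Fintype ι] [DecidableEq ι]
    (hι : 3 ≤ Fintype.card ι) (i j : ι) : ∑ c : ι → ZMod 2, c i * c j = 0 := by
  obtain ⟨k, -, hk⟩ := exists_mem_notMem_of_card_lt_card (s := {i, j}) (t := univ)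
    (card_le_two.trans_lt hι)
  obtain ⟨hki, hkj⟩ : k ≠ i ∧ k ≠ j := by simpa using hk
  refine sum_involution (fun c _ => c + Pi.single k 1) (fun c _ => ?_)
    (fun c _ _ => by simp) (fun c _ => mem_univ _) fun c _ => ?_
  · simp [hki.symm, hkj.symm, CharTwo.add_self_eq_zero]
  · rw [add_assoc, ZModModule.add_self, add_zero]

theorem sum_mul_eq_zero_of_three_le_finrank {V A : Type*} [AddCommGroup V] [Module (ZMod 2) V]
    [Fintype V] [Semiring A] [Algebra (ZMod 2) A] (hV : 3 ≤ finrank (ZMod 2) V)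
    (p q : V →ₗ[ZMod 2] A) : ∑ x, p x * q x = 0 := by
  classical
  let b := finBasis (ZMod 2) V
  have hcoord (r : V →ₗ[ZMod 2] A) (c : Fin (finrank (ZMod 2) V) → ZMod 2) :
      r (b.equivFun.symm c) = ∑ i, c i • r (b i) := by
    simp [b.equivFun_symm_apply]
  calc ∑ x, p x * q x
      = ∑ c : Fin (finrank (ZMod 2) V) → ZMod 2, ∑ i, ∑ j, (c i * c j) • (p (b i) * q (b j)) := by
        rw [← b.equivFun.symm.toEquiv.sum_comp]
        simp_rw [LinearEquiv.coe_toEquiv, hcoord, sum_mul_sum, smul_mul_smul_comm]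
    _ = ∑ i, ∑ j, (∑ c : Fin (finrank (ZMod 2) V) → ZMod 2, c i * c j) •
          (p (b i) * q (b j)) := by
        simp_rw [sum_smul]
        rw [sum_comm]
        exact sum_congr rfl fun i _ => sum_comm
    _ = 0 := by
        rw [← Fintype.card_fin (finrank (ZMod 2) V)] at hV
        simp [sum_mul_eq_zero_of_three_le_card hV]

variable {L : Type*} [Field L] [Fintype L] [Algebra (ZMod 2) L]

theorem sum_column_pow_three_pow_five_eq_zero (V : Submodule (ZMod 2) L)
    [DecidablePred (· ∈ V)] (hV : 3 ≤ finrank (ZMod 2) V) :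
    ∑ x with x ∈ V, column (· ^ 3) (· ^ 5) x = 0 := by
  have hprod (p q : L →ₗ[ZMod 2] L) : ∑ x with x ∈ V, p x * q x = 0 := by
    rw [sum_subtype (p := (· ∈ V)) _ (by simp) fun x => p x * q x]
    exact sum_mul_eq_zero_of_three_le_finrank hV (p ∘ₗ V.subtype) (q ∘ₗ V.subtype)
  have hsqrt (x : L) : (frob L).symm x * (frob L).symm x = x := by
    have hfrob := frob_pow_apply 1 ((frob L).symm x)
    rwa [pow_one, AlgEquiv.apply_symm_apply, pow_one, pow_two, eq_comm] at hfrob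
  -- Each of `x`, `x ^ 3`, `x ^ 5` is a product of two additive functions of `x`.
  have h₁ := hprod (frob L).symm.toLinearMap (frob L).symm.toLinearMap
  have h₃ := hprod LinearMap.id (frob L ^ 1).toLinearMap
  have h₅ := hprod LinearMap.id (frob L ^ 2).toLinearMap
  simp only [AlgEquiv.toLinearMap_apply, LinearMap.id_apply, hsqrt, frob_pow_apply,
    ← pow_succ'] at h₁ h₃ h₅
  ext i
  fin_cases i <;> simpa [column, Finset.sum_apply]

theorem exists_mem_bchCode_hammingNorm_eq_seven [DecidableEq L] {n : ℕ}
    (B : Basis (Fin n) (ZMod 2) L) (hn : 3 ≤ n) : ∃ u ∈ bchCode B, hammingNorm u = 7 := by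
  classical
  let V := Submodule.span (ZMod 2) (Set.range fun i : Fin 3 => B (Fin.castLE hn i))
  have hV : finrank (ZMod 2) V = 3 := by
    rw [finrank_span_eq_card, Fintype.card_fin]
    exact B.linearIndependent.comp _ (Fin.castLE_injective hn)
  refine ⟨fun x => if (x : L) ∈ V then 1 else 0, ?_, ?_⟩
  · have hcol := sum_column_pow_three_pow_five_eq_zero V hV.ge
    have h₀ : column (· ^ 3) (· ^ 5) (0 : L) = 0 := by simp [column]
    rw [sum_filter, sum_eq_add_sum_units fun x : L =>
      if x ∈ V then column (· ^ 3) (· ^ 5) x else 0, h₀, ite_self, zero_add] at hcol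
    rw [bchCode, mem_code_iff_sum_filter, sum_filter]
    simpa using hcol
  · have hcard := card_eq_pow_finrank (K := ZMod 2) (V := V)
    rw [hV, ZMod.card, Fintype.card_subtype, card_filter,
      sum_eq_add_sum_units fun x : L => if x ∈ V then 1 else 0, if_pos V.zero_mem] at hcard
    simp only [hammingNorm, card_filter, ite_ne_right_iff, ne_eq, one_ne_zero, not_false_eq_true,
      and_true]
    lia

theorem weightCount_ne_zero_iff {ι : Type*} [Fintype ι] {C : Submodule (ZMod 2) (ι → ZMod 2)}
    {w : ℕ} : weightCount C w ≠ 0 ↔ ∃ u ∈ C, hammingNorm u = w := by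
  rw [weightCount, ← Nat.pos_iff_ne_zero, Set.ncard_pos]
  rfl

theorem HasBCHSpectrum.hasMinDist_seven [DecidableEq L] {f g : L → L} (h : HasBCHSpectrum f g)
    (hL : Odd (finrank (ZMod 2) L)) {n : ℕ} (hn : 3 ≤ n) (B : Basis (Fin n) (ZMod 2) L) :
    HasMinDist (code B f g) 7 := by
  constructor
  · have hbch := hasBCHSpectrum_pow_three_pow_five hL
    obtain ⟨u, hu, hu₇⟩ : ∃ u ∈ code B f g, hammingNorm u = 7 := by
      rw [← weightCount_ne_zero_iff, h.weightCount_eq B hbch hL]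
      exact weightCount_ne_zero_iff.2 (exists_mem_bchCode_hammingNorm_eq_seven B hn)
    refine ⟨u, hu, 0, zero_mem _, ?_, by rw [hammingDist_zero_right, hu₇]⟩
    rintro rfl
    simp at hu₇
  · rintro m ⟨u, hu, v, hv, huv, rfl⟩
    rw [hammingDist_eq_hammingNorm]
    exact h.seven_le_hammingNorm B (add_mem (neg_mem hu) hv) fun h₀ =>
      huv (neg_add_eq_zero.1 h₀)

end MinimumDistance

end TripleCode

theorem theorem2 (n k : ℕ) (hn : Odd n) (hk : Nat.Coprime k n)
    {L : Type*} [Field L] [Fintype L] [DecidableEq L] [Algebra (ZMod 2) L]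
    (hL : Fintype.card L = 2 ^ n) (B : Module.Basis (Fin n) (ZMod 2) L) :
    (∀ a b c : L, ¬(a = 0 ∧ b = 0 ∧ c = 0) →
      TripleCode.fourier (TripleCode.powF k) (TripleCode.powG k) a b c ∈
        ({0, 2 ^ ((n + 1) / 2), -2 ^ ((n + 1) / 2), 2 ^ ((n + 3) / 2), -2 ^ ((n + 3) / 2)} :
          Set ℤ)) ∧
    (3 ≤ n → TripleCode.HasMinDist
      (TripleCode.code B (TripleCode.powF k) (TripleCode.powG k)) 7) ∧
    (5 ≤ n → TripleCode.HasParameters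
      (TripleCode.code B (TripleCode.powF k) (TripleCode.powG k))
        (2 ^ n - 1) (2 ^ n - 3 * n - 1) 7) ∧
    (∀ w : ℕ, TripleCode.weightCount
      (TripleCode.code B (TripleCode.powF k) (TripleCode.powG k)) w =
        TripleCode.weightCount (TripleCode.bchCode B) w) := by
  obtain rfl : Module.finrank (ZMod 2) L = n := by
    rw [Module.finrank_eq_card_basis B, Fintype.card_fin]
  have h := TripleCode.hasBCHSpectrum_powF_powG hn hk
  have hbch := TripleCode.hasBCHSpectrum_pow_three_pow_five hn
  refine ⟨fun a b c habc => ?_, (h.hasMinDist_seven hn · B), fun hn₅ => ⟨?_, ?_, ?_⟩,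
    h.weightCount_eq B hbch hn⟩
  · have ht : ![a, b, c] ≠ 0 := fun h₀ => habc (by simpa using h₀)
    have hW := h.walsh_mem hn hL ht
    rwa [TripleCode.walsh_column] at hW
  · rw [Fintype.card_units, hL]
  · have hdim := h.finrank_code B (hL ▸ Nat.pow_lt_pow_right one_lt_two (m := 3) (by lia))
    rw [Fintype.card_units, hL] at hdim
    lia
  · exact h.hasMinDist_seven hn (by lia) B
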